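/- Let $\mathbb D=\{z\in\mathbb C:|z|<1\}$. For a domain $D\subset\mathbb C$ and $p\in D$ let $$M_D(p)=\sup\{\|df_0\| : f:\mathbb D\to D \text{ harmonic},\ f(0)=p,\ df_0 \text{ conformal}\},$$ where $\|df_0\|$ is the operator norm and $df_0=0$ is admitted as a degenerate conformal map. A map $f$ admitted in this supremum is called extremal if $M_D(p)<\infty$ and $\|df_0\|=M_D(p)$. A bounded strongly convex domain is a nonempty bounded open convex set with $C^2$ boundary of everywhere positive curvature. Let $F(z)=\sqrt2\,\arctan(z/\sqrt2)$ (principal branch) and $D=F(\mathbb D)$. Then: 1. $D$ is a bounded strongly convex domain, $0\in D$, and $D$ is not a disc. 2. $F:\mathbb D\to D$ is biholomorphic, $F(0)=0$, and $M_D(0)$ is finite and attained by $F$: $M_D(0)=\|dF_0\|$. 3. The extremal maps $f:\mathbb D\to D$ with $f(0)=0$ whose differential at $0$ preserves orientation are precisely the maps $z\mapsto F(e^{i\theta}z)$, $\theta\in\mathbb R$. The only one of them satisfying the normalization $f_z(0)>0$, where $f_z=\frac12(f_x-if_y)$, is $F$. In particular, the following question has a negative answer: if $D$ is a bounded strongly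 convex domain and $p\in D$ is a point for which $M_D(p)$ is attained by a biholomorphic map $\Phi:\mathbb D\to D$ with $\Phi(0)=p$, must $D$ be a round disc? -/

import Mathlib

open Set Metric InnerProductSpace

noncomputable section

/-- The open unit disc in `ℂ`. -/
abbrev unitDisc : Set ℂ := ball (0 : ℂ) 1

/-- Bounded strongly convex domain in `ℂ`: a nonempty bounded open convex (hence connected) set
whose boundary is of class `C²` and has everywhere positive curvature. The latter is expressed
through local defining functions `ρ`: near every boundary point `p` the set is `{ρ < 0}` with `ρ`
of class `C²`, the differential `dρ_p` does not vanish, and the Hessian of `ρ` at `p` is positive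
definite on the tangent line `ker dρ_p` of the boundary. -/
structure IsBoundedStronglyConvexDomain (D : Set ℂ) : Prop where
  nonempty : D.Nonempty
  isOpen : IsOpen D
  isBounded : Bornology.IsBounded D
  convex : Convex ℝ D
  boundary : ∀ p ∈ frontier D, ∃ (U : Set ℂ) (ρ : ℂ → ℝ),
    IsOpen U ∧ p ∈ U ∧ ContDiffOn ℝ 2 ρ U ∧ D ∩ U = {w ∈ U | ρ w < 0} ∧
    fderiv ℝ ρ p ≠ 0 ∧
    ∀ v : ℂ, v ≠ 0 → fderiv ℝ ρ p v = 0 → 0 < fderiv ℝ (fderiv ℝ ρ) p v v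

/-- `D` is a round (open) disc. -/
def IsRoundDisc (D : Set ℂ) : Prop := ∃ (c : ℂ) (r : ℝ), D = ball c r

/-- `F` restricts to a biholomorphic map of `U` onto `V`. -/
def IsBiholomorphicOnto (F : ℂ → ℂ) (U V : Set ℂ) : Prop :=
  DifferentiableOn ℂ F U ∧ BijOn F U V ∧
    ∃ G : ℂ → ℂ, DifferentiableOn ℂ G V ∧ InvOn G F U V

/-- `f` (restricted to the unit disc) is a competitor in the extremal problem: a harmonic map
`𝔻 → D` with `f 0 = p` whose differential at `0` is conformal. As usual in this context, the zero
differential is admitted as a (degenerate) conformal map. -/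
structure IsCompetitor (D : Set ℂ) (p : ℂ) (f : ℂ → ℂ) : Prop where
  mapsTo : MapsTo f unitDisc D
  harmonic : HarmonicOnNhd f unitDisc
  map_zero : f 0 = p
  conformal : fderiv ℝ f 0 = 0 ∨ IsConformalMap (fderiv ℝ f 0)

/-- The set of the numbers `‖df₀‖` (operator norm) of all competitors `f`. -/
def competitorNorms (D : Set ℂ) (p : ℂ) : Set ℝ :=
  {s | ∃ f : ℂ → ℂ, IsCompetitor D p f ∧ s = ‖fderiv ℝ f 0‖}

/-- The number `M_D(p)`, the supremum of `‖df₀‖` over all competitors `f`. -/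
def extremalValue (D : Set ℂ) (p : ℂ) : ℝ := sSup (competitorNorms D p)

/-- `f` is extremal: a competitor at which the supremum `M_D(p)`, which is finite, is attained. -/
def IsExtremal (D : Set ℂ) (p : ℂ) (f : ℂ → ℂ) : Prop :=
  IsCompetitor D p f ∧ BddAbove (competitorNorms D p) ∧ ‖fderiv ℝ f 0‖ = extremalValue D p

/-- The differential of `f` at `0` preserves orientation. -/
def OrientationPreservingAtZero (f : ℂ → ℂ) : Prop := 0 < (fderiv ℝ f 0).det

/-- The Wirtinger derivative `f_z = (f_x - i f_y) / 2`. -/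
def wirtingerDz (f : ℂ → ℂ) (z : ℂ) : ℂ :=
  (fderiv ℝ f z 1 - Complex.I * fderiv ℝ f z Complex.I) / 2

/-- The map `F z = √2 arctan (z / √2)`, with the principal branch of `arctan`. -/
def arctanMap (z : ℂ) : ℂ := (√2 : ℝ) * Complex.arctan (z / (√2 : ℝ))

/-- The image of the unit disc under `arctanMap`. -/
def arctanDomain : Set ℂ := arctanMap '' unitDisc

end

open scoped ComplexConjugate

/-- A function whose second derivative is at least `1` lies above its tangents, with a quadratic
gain. -/
theorem tangent_add_sq_le {φ φ' φ'' : ℝ → ℝ} {S : Set ℝ} (hS : Convex ℝ S)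
    (h₁ : ∀ t, HasDerivAt φ (φ' t) t) (h₂ : ∀ t, HasDerivAt φ' (φ'' t) t)
    (h₃ : ∀ t ∈ interior S, 1 ≤ φ'' t) {x y : ℝ} (hx : x ∈ S) (hy : y ∈ S) :
    φ x + φ' x * (y - x) + (y - x) ^ 2 / 2 ≤ φ y := by
  have d₁ : ∀ t, HasDerivAt (fun t => φ t - t ^ 2 / 2) (φ' t - t) t := fun t => by
    have := (h₁ t).sub (((hasDerivAt_id t).pow 2).div_const 2)
    refine this.congr_deriv ?_
    simp
  have d₂ : ∀ t, HasDerivAt (fun t => φ' t - t) (φ'' t - 1) t := fun t =>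
    (h₂ t).sub (hasDerivAt_id t)
  have hconv : ConvexOn ℝ S (fun t => φ t - t ^ 2 / 2) :=
    convexOn_of_hasDerivWithinAt2_nonneg hS (fun t _ => (d₁ t).continuousAt.continuousWithinAt)
      (fun t _ => (d₁ t).hasDerivWithinAt) (fun t _ => (d₂ t).hasDerivWithinAt)
      (fun t ht => sub_nonneg.2 (h₃ t ht))
  rcases lt_trichotomy x y with hxy | rfl | hxy
  · have := hconv.le_slope_of_hasDerivAt hx hy hxy (d₁ x)
    rw [slope_def_field, le_div_iff₀ (sub_pos.2 hxy)] at this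
    nlinarith
  · simp
  · have := hconv.slope_le_of_hasDerivAt hy hx hxy (d₁ x)
    rw [slope_def_field, div_le_iff₀ (sub_pos.2 hxy)] at this
    nlinarith

theorem cosh_tangent_add_sq_le (x y : ℝ) :
    Real.cosh x + Real.sinh x * (y - x) + (y - x) ^ 2 / 2 ≤ Real.cosh y :=
  tangent_add_sq_le convex_univ Real.hasDerivAt_cosh Real.hasDerivAt_sinh
    (fun t _ => Real.one_le_cosh t) (mem_univ x) (mem_univ y)

theorem neg_cos_tangent_add_sq_le {x y : ℝ} (hx : |x| ≤ Real.arccos (1 / 3))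
    (hy : |y| ≤ Real.arccos (1 / 3)) :
    -3 * Real.cos x + 3 * Real.sin x * (y - x) + (y - x) ^ 2 / 2 ≤ -3 * Real.cos y := by
  refine tangent_add_sq_le (φ := fun t => -3 * Real.cos t) (φ' := fun t => 3 * Real.sin t)
    (φ'' := fun t => 3 * Real.cos t)
    (convex_Icc (-Real.arccos (1 / 3)) (Real.arccos (1 / 3)))
    (fun t => ((Real.hasDerivAt_cos t).const_mul _).congr_deriv (by ring))
    (fun t => (Real.hasDerivAt_sin t).const_mul _) (fun t ht => ?_) (abs_le.1 hx) (abs_le.1 hy)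
  have ht' := abs_le.2 (mem_Icc.1 (interior_subset ht))
  have := Real.cos_le_cos_of_nonneg_of_le_pi (abs_nonneg t) (Real.arccos_le_pi _) ht'
  rw [Real.cos_abs, Real.cos_arccos (by norm_num) (by norm_num)] at this
  linarith

theorem abs_le_arccos_third {x : ℝ} (hx : |x| < Real.pi / 2) (h : 1 ≤ 3 * Real.cos x) :
    |x| ≤ Real.arccos (1 / 3) := by
  by_contra! hlt
  have := Real.cos_lt_cos_of_nonneg_of_le_pi (Real.arccos_nonneg _)
    (by linarith [Real.pi_pos]) hlt
  rw [Real.cos_abs, Real.cos_arccos (by norm_num) (by norm_num)] at this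
  linarith

/-- The strictly convex function whose negativity defines `arctanDomain` inside a strip. -/
noncomputable def arctanDefining (w : ℂ) : ℝ :=
  Real.cosh (√2 * w.im) - 3 * Real.cos (√2 * w.re)

/-- The vertical strip on which `arctanDefining` is convex. -/
def arctanStrip : Set ℂ := {w | |√2 * w.re| < Real.pi / 2}

theorem isOpen_arctanStrip : IsOpen arctanStrip :=
  isOpen_lt (by fun_prop) continuous_const

theorem continuous_arctanDefining : Continuous arctanDefining := by
  unfold arctanDefining
  fun_prop

/-- Strong convexity of `arctanDefining` on its sublevel set. -/
theorem arctanDefining_tangent_add_sq_le {w w₀ : ℂ} (hw : w ∈ arctanStrip)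
    (hw₀ : w₀ ∈ arctanStrip) (h : arctanDefining w ≤ 0) (h₀ : arctanDefining w₀ ≤ 0) :
    arctanDefining w₀ + 3 * √2 * Real.sin (√2 * w₀.re) * (w.re - w₀.re)
      + √2 * Real.sinh (√2 * w₀.im) * (w.im - w₀.im) + ‖w - w₀‖ ^ 2 ≤ arctanDefining w := by
  have hs : √2 * √2 = (2 : ℝ) := Real.mul_self_sqrt (by norm_num)
  have aux : ∀ w : ℂ, w ∈ arctanStrip → arctanDefining w ≤ 0 →
      |√2 * w.re| ≤ Real.arccos (1 / 3) := fun w hw h =>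
    abs_le_arccos_third hw (by
      unfold arctanDefining at h
      linarith [Real.one_le_cosh (√2 * w.im)])
  have h1 := neg_cos_tangent_add_sq_le (aux w₀ hw₀ h₀) (aux w hw h)
  have h2 := cosh_tangent_add_sq_le (√2 * w₀.im) (√2 * w.im)
  have h3 : ‖w - w₀‖ ^ 2 = (w.re - w₀.re) ^ 2 + (w.im - w₀.im) ^ 2 := by
    rw [← Complex.normSq_eq_norm_sq, Complex.normSq_apply, Complex.sub_re, Complex.sub_im]
    ring
  have h4 : ∀ a b : ℝ, (√2 * a - √2 * b) ^ 2 / 2 = (a - b) ^ 2 := fun a b => by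
    rw [← mul_sub, mul_pow, sq √2, hs]; ring
  rw [h4] at h1 h2
  rw [h3]
  unfold arctanDefining
  linarith

namespace Complex

theorem re_one_add_div_one_sub_pos {z : ℂ} (hz : ‖z‖ < 1) :
    0 < ((1 + z * I) / (1 - z * I)).re := by
  have hne : (1 : ℂ) - z * I ≠ 0 := fun h => by
    have : ‖z * I‖ = 1 := by rw [← sub_eq_zero.1 h, norm_one]
    simp at this
    linarith
  have hsq : normSq z < 1 := by
    rw [normSq_eq_norm_sq]; nlinarith [norm_nonneg z]
  rw [div_re, ← add_div]
  refine div_pos ?_ (normSq_pos.2 hne)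
  rw [normSq_apply] at hsq
  simp
  linarith

theorem abs_re_arctan_lt {z : ℂ} (hz : ‖z‖ < 1) : |(arctan z).re| < Real.pi / 4 := by
  have h := abs_arg_lt_pi_div_two_iff.2 (Or.inl (re_one_add_div_one_sub_pos hz))
  have : (arctan z).re = arg ((1 + z * I) / (1 - z * I)) / 2 := by
    rw [arctan, ← log_im]
    simp [Complex.mul_re]
    ring
  rw [this, abs_div, abs_two]
  linarith

theorem hasDerivAt_arctan {z : ℂ} (hz : ‖z‖ < 1) : HasDerivAt arctan (1 / (1 + z ^ 2)) z := by
  have hq := re_one_add_div_one_sub_pos hz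
  have h1 : (1 : ℂ) - z * I ≠ 0 := fun h => by simp [h] at hq
  have h2 : (1 : ℂ) + z * I ≠ 0 := fun h => by simp [h] at hq
  have h3 : 1 + z ^ 2 = (1 - z * I) * (1 + z * I) := by
    ring_nf; rw [I_sq]; ring
  have hd := ((((hasDerivAt_id z).mul_const I).const_add 1).div
    (((hasDerivAt_id z).mul_const I).const_sub 1) h1).clog (Or.inl hq)
  refine (hd.const_mul (-I / 2)).congr_deriv ?_
  rw [h3]
  simp only [id, Pi.div_apply]
  field_simp
  ring_nf
  simp [I_sq]

theorem ne_I_of_norm_lt_one {z : ℂ} (hz : ‖z‖ < 1) : z ≠ I ∧ z ≠ -I := by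
  constructor <;> rintro rfl <;> simp at hz

theorem tan_arctan_of_norm_lt_one {z : ℂ} (hz : ‖z‖ < 1) : tan (arctan z) = z :=
  tan_arctan (ne_I_of_norm_lt_one hz).1 (ne_I_of_norm_lt_one hz).2

/-- `sin u * conj (cos u)` in terms of the real and the imaginary part of `2 u`. -/
theorem two_mul_sin_mul_conj_cos (u : ℂ) :
    2 * (sin u * starRingEnd ℂ (cos u)) =
      (Real.sin (2 * u.re) : ℂ) + (Real.sinh (2 * u.im) : ℂ) * I := by
  rw [ofReal_sin, ofReal_sinh, ← sin_mul_I, ← add_conj, ← sub_conj, ← cos_conj, sin_add, sin_sub]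
  ring

theorem two_mul_norm_cos_sq (u : ℂ) :
    2 * ‖cos u‖ ^ 2 = Real.cosh (2 * u.im) + Real.cos (2 * u.re) := by
  rw [← ofReal_inj]
  push_cast
  rw [← mul_conj', ← cos_conj, ← cos_mul_I, ← ofReal_ofNat, ← ofReal_mul, ← ofReal_mul, ← add_conj,
    ← sub_conj, cos_add, cos_sub]
  push_cast
  ring

theorem two_mul_norm_sin_sq (u : ℂ) :
    2 * ‖sin u‖ ^ 2 = Real.cosh (2 * u.im) - Real.cos (2 * u.re) := by
  rw [← ofReal_inj]
  push_cast
  rw [← mul_conj', ← sin_conj, ← cos_mul_I, ← ofReal_ofNat, ← ofReal_mul, ← ofReal_mul, ← add_conj,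
    ← sub_conj, cos_add, cos_sub]
  push_cast
  ring

end Complex

theorem norm_div_sqrt_two_lt_one {z : ℂ} (hz : ‖z‖ < √2) : ‖z / (√2 : ℝ)‖ < 1 := by
  rw [norm_div, Complex.norm_real, Real.norm_of_nonneg (Real.sqrt_nonneg 2),
    div_lt_one (by positivity)]
  exact hz

theorem sqrt_two_mul_arctanMap_re (z : ℂ) :
    √2 * (arctanMap z).re = 2 * (Complex.arctan (z / (√2 : ℝ))).re := by
  rw [arctanMap, Complex.re_ofReal_mul, ← mul_assoc, Real.mul_self_sqrt (by norm_num)]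

theorem sqrt_two_mul_arctanMap_im (z : ℂ) :
    √2 * (arctanMap z).im = 2 * (Complex.arctan (z / (√2 : ℝ))).im := by
  rw [arctanMap, Complex.im_ofReal_mul, ← mul_assoc, Real.mul_self_sqrt (by norm_num)]

theorem arctanMap_mem_strip {z : ℂ} (hz : ‖z‖ < √2) : arctanMap z ∈ arctanStrip := by
  have := Complex.abs_re_arctan_lt (norm_div_sqrt_two_lt_one hz)
  change |√2 * _| < _
  rw [sqrt_two_mul_arctanMap_re, abs_mul, abs_two]
  linarith

theorem hasDerivAt_arctanMap {z : ℂ} (hz : ‖z‖ < √2) :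
    HasDerivAt arctanMap (1 / (1 + z ^ 2 / 2)) z := by
  have h := (Complex.hasDerivAt_arctan (norm_div_sqrt_two_lt_one hz)).comp z
    ((hasDerivAt_id z).div_const ((√2 : ℝ) : ℂ))
  refine (h.const_mul ((√2 : ℝ) : ℂ)).congr_deriv ?_
  have hs : ((√2 : ℝ) : ℂ) ≠ 0 := by simp
  have hs2 : ((√2 : ℝ) : ℂ) ^ 2 = 2 := by
    rw [← Complex.ofReal_pow, Real.sq_sqrt (by norm_num)]; simp
  rw [div_pow, hs2]
  field_simp

theorem arctanMap_zero : arctanMap 0 = 0 := by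
  simp [arctanMap, Complex.arctan]

/-- The defining function and its gradient at `arctanMap z`, with
`k = ‖cos (arctan (z / √2))‖ ^ 2`. -/
theorem exists_arctanDefining_arctanMap_eq {z : ℂ} (hz : ‖z‖ < √2) :
    ∃ k : ℝ, 0 < k ∧ arctanDefining (arctanMap z) = 2 * (‖z‖ ^ 2 - 1) * k ∧
      Real.sin (√2 * (arctanMap z).re) = √2 * k * z.re ∧
      Real.sinh (√2 * (arctanMap z).im) = √2 * k * z.im ∧
      2 * k = Real.cosh (√2 * (arctanMap z).im) + Real.cos (√2 * (arctanMap z).re) := by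
  set u := Complex.arctan (z / (√2 : ℝ)) with hu
  have hsq : √2 * √2 = (2 : ℝ) := Real.mul_self_sqrt (by norm_num)
  have hs : ((√2 : ℝ) : ℂ) ≠ 0 := by simp
  have hre := Complex.abs_re_arctan_lt (norm_div_sqrt_two_lt_one hz)
  have hcos : Complex.cos u ≠ 0 := by
    have := abs_lt.1 hre
    refine Complex.cos_ne_zero_of_arctan_bounds (fun h => ?_) ?_ ?_
    · have h' := congrArg Complex.re h
      norm_cast at h'
      linarith [Real.pi_pos]
    · linarith [Real.pi_pos]
    · linarith [Real.pi_pos]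
  have htan := Complex.tan_arctan_of_norm_lt_one (norm_div_sqrt_two_lt_one hz)
  rw [← hu, Complex.tan_eq_sin_div_cos, div_eq_iff hcos] at htan
  have hns : ‖Complex.sin u‖ ^ 2 = ‖z‖ ^ 2 / 2 * ‖Complex.cos u‖ ^ 2 := by
    rw [htan, norm_mul, norm_div, Complex.norm_real, Real.norm_of_nonneg (Real.sqrt_nonneg 2),
      mul_pow, div_pow, Real.sq_sqrt (by norm_num)]
  have hgrad := Complex.two_mul_sin_mul_conj_cos u
  rw [htan, mul_assoc, Complex.mul_conj'] at hgrad
  have hgrad' : ((√2 * ‖Complex.cos u‖ ^ 2 : ℝ) : ℂ) * z =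
      (Real.sin (2 * u.re) : ℂ) + (Real.sinh (2 * u.im) : ℂ) * Complex.I := by
    rw [← hgrad]
    have : (2 : ℂ) = ((√2 : ℝ) : ℂ) * ((√2 : ℝ) : ℂ) := by
      rw [← Complex.ofReal_mul, hsq]; simp
    rw [this]
    push_cast
    field_simp
  refine ⟨‖Complex.cos u‖ ^ 2, by positivity, ?_, ?_, ?_, ?_⟩
  · rw [arctanDefining, sqrt_two_mul_arctanMap_im, sqrt_two_mul_arctanMap_re, ← hu]
    linarith [Complex.two_mul_norm_cos_sq u, Complex.two_mul_norm_sin_sq u]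
  · rw [sqrt_two_mul_arctanMap_re, ← hu]
    have := congrArg Complex.re hgrad'
    rw [Complex.re_ofReal_mul] at this
    simpa [-Complex.ofReal_sin, -Complex.ofReal_sinh] using this.symm
  · rw [sqrt_two_mul_arctanMap_im, ← hu]
    have := congrArg Complex.im hgrad'
    rw [Complex.im_ofReal_mul] at this
    simpa [-Complex.ofReal_sin, -Complex.ofReal_sinh] using this.symm
  · rw [sqrt_two_mul_arctanMap_im, sqrt_two_mul_arctanMap_re, ← hu, Complex.two_mul_norm_cos_sq]

theorem one_lt_sqrt_two : (1 : ℝ) < √2 := by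
  rw [Real.lt_sqrt] <;> norm_num

/-- The inverse of `arctanMap`. -/
noncomputable def tanMap (w : ℂ) : ℂ := (√2 : ℝ) * Complex.tan (w / (√2 : ℝ))

theorem tanMap_arctanMap {z : ℂ} (hz : ‖z‖ < √2) : tanMap (arctanMap z) = z := by
  have hs : ((√2 : ℝ) : ℂ) ≠ 0 := by simp
  rw [tanMap, arctanMap, mul_div_cancel_left₀ _ hs,
    Complex.tan_arctan_of_norm_lt_one (norm_div_sqrt_two_lt_one hz), mul_div_cancel₀ _ hs]

theorem div_sqrt_two_re_bounds {w : ℂ} (hw : w ∈ arctanStrip) :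
    |(w / (√2 : ℝ)).re| < Real.pi / 2 ∧ √2 * w.re = 2 * (w / (√2 : ℝ)).re ∧
      √2 * w.im = 2 * (w / (√2 : ℝ)).im := by
  have hsq : √2 * √2 = (2 : ℝ) := Real.mul_self_sqrt (by norm_num)
  have hs : (√2 : ℝ) ≠ 0 := by simp
  have h1 : √2 * w.re = 2 * (w / (√2 : ℝ)).re := by
    rw [Complex.div_ofReal_re, mul_div_assoc', eq_div_iff hs]; linear_combination w.re * hsq
  have h2 : √2 * w.im = 2 * (w / (√2 : ℝ)).im := by
    rw [Complex.div_ofReal_im, mul_div_assoc', eq_div_iff hs]; linear_combination w.im * hsq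
  refine ⟨?_, h1, h2⟩
  have hw' : |√2 * w.re| < Real.pi / 2 := hw
  rw [h1, abs_mul, abs_two] at hw'
  linarith [abs_nonneg (w / (√2 : ℝ)).re]

theorem cos_div_sqrt_two_ne_zero {w : ℂ} (hw : w ∈ arctanStrip) :
    Complex.cos (w / (√2 : ℝ)) ≠ 0 ∧ Complex.arctan (Complex.tan (w / (√2 : ℝ))) = w / (√2 : ℝ) := by
  obtain ⟨h, -, -⟩ := div_sqrt_two_re_bounds hw
  have h' := abs_lt.1 h
  have hne : w / (√2 : ℝ) ≠ Real.pi / 2 := fun he => by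
    have h2 := congrArg Complex.re he
    norm_cast at h2
    linarith
  exact ⟨Complex.cos_ne_zero_of_arctan_bounds hne h'.1 h'.2.le,
    Complex.arctan_tan hne h'.1 h'.2.le⟩

theorem arctanMap_tanMap {w : ℂ} (hw : w ∈ arctanStrip) : arctanMap (tanMap w) = w := by
  have hs : ((√2 : ℝ) : ℂ) ≠ 0 := by simp
  rw [arctanMap, tanMap, mul_div_cancel_left₀ _ hs, (cos_div_sqrt_two_ne_zero hw).2,
    mul_div_cancel₀ _ hs]

theorem arctanDomain_eq : arctanDomain = {w ∈ arctanStrip | arctanDefining w < 0} := by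
  ext w
  constructor
  · rintro ⟨z, hz, rfl⟩
    have hz1 : ‖z‖ < 1 := mem_ball_zero_iff.1 hz
    have hz2 := hz1.trans one_lt_sqrt_two
    obtain ⟨k, hk, h, -⟩ := exists_arctanDefining_arctanMap_eq hz2
    refine ⟨arctanMap_mem_strip hz2, ?_⟩
    rw [h]
    have : ‖z‖ ^ 2 < 1 := by nlinarith [norm_nonneg z]
    nlinarith
  · rintro ⟨hw, h⟩
    refine ⟨tanMap w, ?_, arctanMap_tanMap hw⟩
    obtain ⟨-, hre, him⟩ := div_sqrt_two_re_bounds hw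
    have hcos := (cos_div_sqrt_two_ne_zero hw).1
    set u := w / (√2 : ℝ)
    rw [arctanDefining, hre, him] at h
    have h1 : 2 * ‖Complex.sin u‖ ^ 2 < ‖Complex.cos u‖ ^ 2 := by
      linarith [Complex.two_mul_norm_cos_sq u, Complex.two_mul_norm_sin_sq u]
    have h2 : ‖tanMap w‖ ^ 2 = 2 * ‖Complex.sin u‖ ^ 2 / ‖Complex.cos u‖ ^ 2 := by
      rw [tanMap, Complex.tan_eq_sin_div_cos, norm_mul, norm_div, Complex.norm_real,
        Real.norm_of_nonneg (Real.sqrt_nonneg 2), mul_pow, div_pow, Real.sq_sqrt (by norm_num)]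
      ring
    have h3 : ‖tanMap w‖ ^ 2 < 1 := by
      rw [h2, div_lt_one (by positivity)]
      exact h1
    rw [mem_ball_zero_iff]
    nlinarith [norm_nonneg (tanMap w)]

/-- The quantitative supporting line inequality: the outward normal of `arctanDomain` at the
boundary point `arctanMap ζ` is a positive multiple of `2 ζ + conj ζ`. -/
theorem re_sub_arctanMap_mul_le {w ζ : ℂ} (hw : w ∈ arctanDomain) (hζ : ‖ζ‖ = 1) :
    ((w - arctanMap ζ) * (2 * starRingEnd ℂ ζ + ζ)).re + ‖w - arctanMap ζ‖ ^ 2 / 4 ≤ 0 := by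
  rw [arctanDomain_eq] at hw
  have hζ2 : ‖ζ‖ < √2 := hζ ▸ one_lt_sqrt_two
  have hsq : √2 * √2 = (2 : ℝ) := Real.mul_self_sqrt (by norm_num)
  obtain ⟨k, hk, h0, h1, h2, h3⟩ := exists_arctanDefining_arctanMap_eq hζ2
  rw [hζ] at h0
  have h0' : arctanDefining (arctanMap ζ) = 0 := by rw [h0]; ring
  have hk2 : k ≤ 2 := by
    have := Real.cos_le_one (√2 * (arctanMap ζ).re)
    unfold arctanDefining at h0'
    linarith
  have key := arctanDefining_tangent_add_sq_le hw.1 (arctanMap_mem_strip hζ2) hw.2.le h0'.le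
  rw [h0', h1, h2] at key
  have hneg := hw.2
  set d := w - arctanMap ζ with hd
  have e1 : w.re - (arctanMap ζ).re = d.re := by simp [hd]
  have e2 : w.im - (arctanMap ζ).im = d.im := by simp [hd]
  rw [e1, e2] at key
  have e3 : (d * (2 * starRingEnd ℂ ζ + ζ)).re = 3 * ζ.re * d.re + ζ.im * d.im := by
    simp [Complex.mul_re]; ring
  rw [e3]
  have key2 : 2 * k * (3 * ζ.re * d.re + ζ.im * d.im) + ‖d‖ ^ 2 ≤ 0 := by
    have : 3 * √2 * (√2 * k * ζ.re) * d.re + √2 * (√2 * k * ζ.im) * d.im =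
      (√2 * √2) * k * (3 * ζ.re * d.re + ζ.im * d.im) := by ring
    rw [hsq] at this
    linarith
  have : 2 * k * (3 * ζ.re * d.re + ζ.im * d.im + ‖d‖ ^ 2 / 4) ≤ 0 := by
    nlinarith [sq_nonneg ‖d‖]
  nlinarith

theorem arctanDomain_subset_strip : arctanDomain ⊆ arctanStrip :=
  fun _ hw => (arctanDomain_eq ▸ hw).1

theorem isOpen_arctanDomain : IsOpen arctanDomain := by
  rw [arctanDomain_eq]
  exact isOpen_arctanStrip.inter (isOpen_lt continuous_arctanDefining continuous_const)

theorem zero_mem_arctanDomain : (0 : ℂ) ∈ arctanDomain :=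
  ⟨0, mem_ball_self one_pos, arctanMap_zero⟩

theorem isBounded_arctanDomain : Bornology.IsBounded arctanDomain := by
  have hs := one_lt_sqrt_two
  rw [isBounded_iff_forall_norm_le]
  refine ⟨2 + 2, fun w hw => ?_⟩
  rw [arctanDomain_eq] at hw
  have h1 : |√2 * w.re| < Real.pi / 2 := hw.1
  have h2 : arctanDefining w < 0 := hw.2
  have h3 := cosh_tangent_add_sq_le 0 (√2 * w.im)
  unfold arctanDefining at h2
  have h4 := Real.cos_le_one (√2 * w.re)
  simp only [Real.cosh_zero, Real.sinh_zero, zero_mul, add_zero, sub_zero] at h3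
  have h5 : (√2 * w.im) ^ 2 = 2 * w.im ^ 2 := by
    rw [mul_pow, Real.sq_sqrt (by norm_num)]
  have h6 : |w.im| ≤ 2 := abs_le_of_sq_le_sq (by nlinarith) (by norm_num)
  have h7 : |w.re| ≤ 2 := by
    rw [abs_mul, abs_of_pos (by linarith)] at h1
    nlinarith [Real.pi_lt_four, abs_nonneg w.re]
  exact (Complex.norm_le_abs_re_add_abs_im w).trans (by linarith)

theorem convex_arctanStrip : Convex ℝ arctanStrip := by
  have : arctanStrip = (fun w : ℂ => √2 * w.re) ⁻¹' ball 0 (Real.pi / 2) := by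
    ext w; simp [arctanStrip]
  rw [this]
  exact (convex_ball _ _).is_linear_preimage
    ⟨fun x y => by simp [mul_add], fun c x => by simp; ring⟩

theorem convex_arctanDomain : Convex ℝ arctanDomain := by
  rw [arctanDomain_eq]
  have hcosh : ConvexOn ℝ univ Real.cosh :=
    convexOn_of_hasDerivWithinAt2_nonneg convex_univ Real.continuous_cosh.continuousOn
      (fun t _ => (Real.hasDerivAt_cosh t).hasDerivWithinAt)
      (fun t _ => (Real.hasDerivAt_sinh t).hasDerivWithinAt) (fun t _ => (Real.cosh_pos t).le)
  have hcos := strictConcaveOn_cos_Icc.concaveOn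
  have hconv : ConvexOn ℝ arctanStrip arctanDefining := by
    refine ⟨convex_arctanStrip, fun x hx y hy a b ha hb hab => ?_⟩
    have h1 := hcosh.2 (mem_univ (√2 * x.im)) (mem_univ (√2 * y.im)) ha hb hab
    have h2 := hcos.2 (abs_le.1 (le_of_lt hx)) (abs_le.1 (le_of_lt hy)) ha hb hab
    simp only [smul_eq_mul] at h1 h2
    have e1 : √2 * (a • x + b • y).im = a * (√2 * x.im) + b * (√2 * y.im) := by simp; ring
    have e2 : √2 * (a • x + b • y).re = a * (√2 * x.re) + b * (√2 * y.re) := by simp; ring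
    unfold arctanDefining
    rw [e1, e2]
    simp only [smul_eq_mul]
    linarith
  exact hconv.convex_lt 0

/-- The differential of `arctanDefining`. -/
noncomputable def arctanDefiningDeriv (w : ℂ) : ℂ →L[ℝ] ℝ :=
  (√2 * Real.sinh (√2 * w.im)) • Complex.imCLM + (3 * √2 * Real.sin (√2 * w.re)) • Complex.reCLM

theorem hasFDerivAt_arctanDefining (w : ℂ) :
    HasFDerivAt arctanDefining (arctanDefiningDeriv w) w := by
  have h1 : HasFDerivAt (fun w : ℂ => √2 * w.im) (√2 • Complex.imCLM) w :=
    Complex.imCLM.hasFDerivAt.const_mul _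
  have h2 : HasFDerivAt (fun w : ℂ => √2 * w.re) (√2 • Complex.reCLM) w :=
    Complex.reCLM.hasFDerivAt.const_mul _
  refine (h1.cosh.sub (h2.cos.const_mul 3)).congr_fderiv ?_
  ext v
  simp [arctanDefiningDeriv]
  ring

theorem fderiv_arctanDefining : fderiv ℝ arctanDefining = arctanDefiningDeriv :=
  funext fun w => (hasFDerivAt_arctanDefining w).fderiv

theorem fderiv_arctanDefiningDeriv_apply (w v : ℂ) :
    fderiv ℝ arctanDefiningDeriv w v v =
      2 * Real.cosh (√2 * w.im) * v.im ^ 2 + 6 * Real.cos (√2 * w.re) * v.re ^ 2 := by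
  have hsq : √2 ^ 2 = (2 : ℝ) := Real.sq_sqrt (by norm_num)
  have h1 : HasFDerivAt (fun w : ℂ => √2 * w.im) (√2 • Complex.imCLM) w :=
    Complex.imCLM.hasFDerivAt.const_mul _
  have h2 : HasFDerivAt (fun w : ℂ => √2 * w.re) (√2 • Complex.reCLM) w :=
    Complex.reCLM.hasFDerivAt.const_mul _
  have h := ((h1.sinh.const_mul √2).smul_const Complex.imCLM).add
    ((h2.sin.const_mul (3 * √2)).smul_const Complex.reCLM)
  have h' : fderiv ℝ arctanDefiningDeriv w = _ := h.fderiv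
  rw [h']
  simp
  linear_combination (Real.cosh (√2 * w.im) * v.im ^ 2 + 3 * Real.cos (√2 * w.re) * v.re ^ 2) * hsq

theorem arctanDefining_frontier {p : ℂ} (hp : p ∈ frontier arctanDomain) :
    p ∈ arctanStrip ∧ arctanDefining p = 0 := by
  have hcl : closure arctanDomain ⊆ {w | |√2 * w.re| ≤ Real.pi / 2 ∧ arctanDefining w ≤ 0} := by
    have hc : Continuous fun w : ℂ => |√2 * w.re| := by fun_prop
    refine closure_minimal (fun w hw => ?_) (IsClosed.and (isClosed_le hc continuous_const)
      (isClosed_le continuous_arctanDefining continuous_const))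
    rw [arctanDomain_eq] at hw
    exact ⟨le_of_lt hw.1, le_of_lt hw.2⟩
  obtain ⟨h1, h2⟩ := hcl (frontier_subset_closure hp)
  have hstrip : p ∈ arctanStrip := by
    refine lt_of_le_of_ne h1 fun he => ?_
    have hc : Real.cos (√2 * p.re) = 0 := by
      rw [← Real.cos_abs, he, Real.cos_pi_div_two]
    unfold arctanDefining at h2
    linarith [Real.one_le_cosh (√2 * p.im)]
  refine ⟨hstrip, h2.antisymm (not_lt.1 fun hlt => ?_)⟩
  have : p ∈ arctanDomain := by
    rw [arctanDomain_eq]; exact ⟨hstrip, hlt⟩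
  exact (isOpen_arctanDomain.frontier_eq ▸ hp).2 this

theorem isBoundedStronglyConvexDomain_arctanDomain :
    IsBoundedStronglyConvexDomain arctanDomain where
  nonempty := ⟨0, zero_mem_arctanDomain⟩
  isOpen := isOpen_arctanDomain
  isBounded := isBounded_arctanDomain
  convex := convex_arctanDomain
  boundary := fun p hp => by
    obtain ⟨hstrip, h0⟩ := arctanDefining_frontier hp
    have hcosp : 0 < Real.cos (√2 * p.re) := by
      unfold arctanDefining at h0
      linarith [Real.one_le_cosh (√2 * p.im)]
    refine ⟨arctanStrip, arctanDefining, isOpen_arctanStrip, hstrip, ?_, ?_, ?_, ?_⟩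
    · have h1 : ContDiff ℝ 2 fun w : ℂ => √2 * w.im := contDiff_const.mul Complex.imCLM.contDiff
      have h2 : ContDiff ℝ 2 fun w : ℂ => √2 * w.re := contDiff_const.mul Complex.reCLM.contDiff
      exact (h1.cosh.sub (contDiff_const.mul h2.cos)).contDiffOn
    · rw [arctanDomain_eq]
      ext w
      exact ⟨fun h => h.1, fun h => ⟨h, h.1⟩⟩
    · rw [fderiv_arctanDefining]
      intro h
      have hs : √2 ≠ 0 := by simp
      have hre := congrArg (fun L : ℂ →L[ℝ] ℝ => L 1) h
      have him := congrArg (fun L : ℂ →L[ℝ] ℝ => L Complex.I) h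
      simp [arctanDefiningDeriv] at hre him
      have habs := abs_lt.1 (show |√2 * p.re| < Real.pi / 2 from hstrip)
      rw [Real.sin_eq_zero_iff_of_lt_of_lt (by linarith [Real.pi_pos])
        (by linarith [Real.pi_pos])] at hre
      unfold arctanDefining at h0
      simp [him] at h0
      rw [hre] at h0
      norm_num at h0
    · intro v hv _
      rw [fderiv_arctanDefining, fderiv_arctanDefiningDeriv_apply]
      have hch := Real.cosh_pos (√2 * p.im)
      rcases eq_or_ne v.re 0 with hre | hre
      · have him : v.im ≠ 0 := fun him => hv (Complex.ext hre him)
        positivity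
      · positivity

theorem not_isRoundDisc_arctanDomain : ¬ IsRoundDisc arctanDomain := by
  rintro ⟨c, r, hcr⟩
  have hs := one_lt_sqrt_two
  have hsq : √2 ^ 2 = (2 : ℝ) := Real.sq_sqrt (by norm_num)
  have hb : 8 / 5 < Real.log 5 := by
    linarith [Real.log_five_gt_d9]
  set b : ℝ := Real.log 5 / √2
  have hb' : √2 * b = Real.log 5 := mul_div_cancel₀ _ (by positivity)
  have hmem : ∀ t : ℝ, |√2 * t| = Real.log 5 → (t : ℂ) * Complex.I ∈ ball c r := fun t ht => by
    rw [← hcr, arctanDomain_eq]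
    refine ⟨by simp [arctanStrip, Real.pi_pos], ?_⟩
    have : Real.cosh (√2 * t) = 13 / 5 := by
      rw [← Real.cosh_abs, ht, Real.cosh_log (by norm_num)]; norm_num
    simp [arctanDefining, this]
    norm_num
  have h1 := mem_ball_iff_norm.1 (hmem b (by rw [hb', abs_of_pos (by linarith)]))
  have h2 := mem_ball_iff_norm.1
    (hmem (-b) (by rw [mul_neg, abs_neg, hb', abs_of_pos (by linarith)]))
  have hbr : b < r := by
    have h3 := (Complex.abs_im_le_norm _).trans_lt h1
    have h4 := (Complex.abs_im_le_norm _).trans_lt h2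
    simp only [Complex.sub_im, Complex.mul_I_im, Complex.ofReal_re] at h3 h4
    linarith [(abs_lt.1 h3).2, (abs_lt.1 h4).1]
  have hb0 : 0 < b := by
    have := Real.log_pos (show (1 : ℝ) < 5 by norm_num)
    positivity
  have hstrip : ∀ t : ℝ, |t| = b → |√2 * (c.re + t)| < Real.pi / 2 := fun t ht => by
    have : c + t ∈ arctanDomain := by
      rw [hcr, mem_ball_iff_norm]
      simpa [ht] using hbr
    simpa [arctanStrip] using arctanDomain_subset_strip this
  have h5 := (abs_lt.1 (hstrip b (abs_of_pos hb0))).2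
  have h6 := (abs_lt.1 (hstrip (-b) (by rw [abs_neg, abs_of_pos hb0]))).1
  rw [mul_add] at h5 h6
  rw [mul_neg] at h6
  linarith [Real.pi_lt_d2]

theorem isBiholomorphicOnto_arctanMap : IsBiholomorphicOnto arctanMap unitDisc arctanDomain := by
  have hlt : ∀ z ∈ unitDisc, ‖z‖ < √2 := fun z hz => (mem_ball_zero_iff.1 hz).trans one_lt_sqrt_two
  have hleft : LeftInvOn tanMap arctanMap unitDisc := fun z hz => tanMap_arctanMap (hlt z hz)
  refine ⟨fun z hz => (hasDerivAt_arctanMap (hlt z hz)).differentiableAt.differentiableWithinAt,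
    hleft.injOn.bijOn_image, tanMap, fun w hw => ?_, hleft,
    fun w hw => arctanMap_tanMap (arctanDomain_subset_strip hw)⟩
  have hcos := (cos_div_sqrt_two_ne_zero (arctanDomain_subset_strip hw)).1
  have h := (Complex.hasDerivAt_tan hcos).comp w
    ((hasDerivAt_id w).div_const ((√2 : ℝ) : ℂ))
  exact (h.const_mul ((√2 : ℝ) : ℂ)).differentiableAt.differentiableWithinAt

/-- A harmonic map on a disc is the sum of a holomorphic and an antiholomorphic map. -/
theorem exists_eq_add_conj_of_harmonicOnNhd {f : ℂ → ℂ} {c : ℂ} {R : ℝ}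
    (hf : HarmonicOnNhd f (ball c R)) :
    ∃ h g : ℂ → ℂ, DifferentiableOn ℂ h (ball c R) ∧ DifferentiableOn ℂ g (ball c R) ∧
      ∀ z ∈ ball c R, f z = h z + conj (g z) := by
  obtain ⟨p, hp, hp'⟩ := (hf.comp_CLM Complex.reCLM).exists_analyticOnNhd_ball_re_eq
  obtain ⟨q, hq, hq'⟩ := (hf.comp_CLM Complex.imCLM).exists_analyticOnNhd_ball_re_eq
  refine ⟨fun z => (p z + Complex.I * q z) / 2, fun z => (p z - Complex.I * q z) / 2,
    (hp.differentiableOn.add (hq.differentiableOn.const_mul _)).div_const _,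
    (hp.differentiableOn.sub (hq.differentiableOn.const_mul _)).div_const _, fun z hz => ?_⟩
  have h1 : (p z).re = (f z).re := hp' hz
  have h2 : (q z).re = (f z).im := hq' hz
  apply Complex.ext
  · rw [Complex.add_re, Complex.conj_re]
    simp [h1]
    ring
  · rw [Complex.add_im, Complex.conj_im]
    simp [h2]
    ring

section CircleAverage

variable {H G : ℂ → ℂ} {R : ℝ}

theorem closedBall_one_subset (hR : 1 < R) : closedBall (0 : ℂ) |1| ⊆ ball 0 R := by
  rw [abs_one]
  exact closedBall_subset_ball hR

theorem sphere_one_subset (hR : 1 < R) : sphere (0 : ℂ) |1| ⊆ ball 0 R :=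
  sphere_subset_closedBall.trans (closedBall_one_subset hR)

theorem circleAverage_mul_self_eq_zero (hR : 1 < R) (hH : DifferentiableOn ℂ H (ball 0 R)) :
    Real.circleAverage (fun z => H z * z) 0 1 = 0 := by
  have hd : DifferentiableOn ℂ (fun z => H z * z) (ball 0 R) := hH.mul differentiableOn_id
  have := (hd.diffContOnCl_ball (closedBall_one_subset hR)).circleAverage
  rw [this, mul_zero]

theorem circleAverage_mul_conj_eq_deriv (hR : 1 < R) (hH : DifferentiableOn ℂ H (ball 0 R)) :
    Real.circleAverage (fun z => H z * conj z) 0 1 = deriv H 0 := by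
  rw [← Complex.two_pi_I_inv_smul_circleIntegral_sub_sq_inv_smul_of_differentiable isOpen_ball
      (closedBall_subset_ball hR) hH (mem_ball_self one_pos),
    Real.circleAverage_eq_circleIntegral one_ne_zero]
  congr 1
  refine circleIntegral.integral_congr zero_le_one fun z hz => ?_
  have hz1 : ‖z‖ = 1 := mem_sphere_zero_iff_norm.1 hz
  have hz0 : z ≠ 0 := fun h => by simp [h] at hz1
  have hinv : conj z = z⁻¹ := (Complex.inv_eq_conj hz1).symm
  simp only [sub_zero, smul_eq_mul, hinv]
  field_simp

theorem circleIntegrable_of_continuousOn_ball {E : Type*} [NormedAddCommGroup E] {u : ℂ → E}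
    (hR : 1 < R) (hu : ContinuousOn u (ball 0 R)) : CircleIntegrable u 0 1 :=
  (hu.mono (sphere_one_subset hR)).circleIntegrable'

theorem circleAverage_conj {u : ℂ → ℂ} (hu : CircleIntegrable u 0 1) :
    Real.circleAverage (fun z => conj (u z)) 0 1 = conj (Real.circleAverage u 0 1) :=
  (Complex.conjCLE : ℂ →L[ℝ] ℂ).circleAverage_comp_comm hu

theorem circleAverage_add_conj_mul (hR : 1 < R) (hH : DifferentiableOn ℂ H (ball 0 R))
    (hG : DifferentiableOn ℂ G (ball 0 R)) :
    Real.circleAverage (fun z => (H z + conj (G z)) * (2 * conj z + z)) 0 1 =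
      2 * deriv H 0 + conj (deriv G 0) := by
  have hcH := hH.continuousOn
  have hcG := hG.continuousOn
  have i1 : CircleIntegrable (fun z => H z * conj z) 0 1 :=
    circleIntegrable_of_continuousOn_ball hR (by fun_prop)
  have i2 : CircleIntegrable (fun z => H z * z) 0 1 :=
    circleIntegrable_of_continuousOn_ball hR (by fun_prop)
  have i3 : CircleIntegrable (fun z => G z * conj z) 0 1 :=
    circleIntegrable_of_continuousOn_ball hR (by fun_prop)
  have i4 : CircleIntegrable (fun z => G z * z) 0 1 :=
    circleIntegrable_of_continuousOn_ball hR (by fun_prop)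
  have i5 : CircleIntegrable (fun z => conj (G z * conj z)) 0 1 :=
    circleIntegrable_of_continuousOn_ball hR (by fun_prop)
  have i6 : CircleIntegrable (fun z => conj (G z * z)) 0 1 :=
    circleIntegrable_of_continuousOn_ball hR (by fun_prop)
  have e : (fun z => (H z + conj (G z)) * (2 * conj z + z)) =
      ((2 : ℂ) • (fun z => H z * conj z) + fun z => H z * z) +
        ((fun z => conj (G z * conj z)) + (2 : ℂ) • fun z => conj (G z * z)) := by
    funext z
    simp only [Pi.add_apply, Pi.smul_apply, map_mul, Complex.conj_conj, smul_eq_mul]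
    ring
  have j1 : CircleIntegrable ((2 : ℂ) • fun z => H z * conj z) 0 1 := .const_smul i1
  have j6 : CircleIntegrable ((2 : ℂ) • fun z => conj (G z * z)) 0 1 := .const_smul i6
  rw [e, Real.circleAverage_add (j1.add i2) (i5.add j6), Real.circleAverage_add j1 i2,
    Real.circleAverage_add i5 j6, Real.circleAverage_smul, Real.circleAverage_smul,
    circleAverage_conj i3, circleAverage_conj i4,
    circleAverage_mul_conj_eq_deriv hR hH, circleAverage_mul_conj_eq_deriv hR hG,
    circleAverage_mul_self_eq_zero hR hH, circleAverage_mul_self_eq_zero hR hG]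
  simp

/-- The value of a harmonic map is controlled by its mean square on the unit circle. -/
theorem norm_sq_le_circleAverage (hR : 1 < R) (hH : DifferentiableOn ℂ H (ball 0 R))
    (hG : DifferentiableOn ℂ G (ball 0 R)) {w : ℂ} (hw : w ∈ ball (0 : ℂ) 1) :
    ‖H w + conj (G w)‖ ^ 2 ≤ ((1 + ‖w‖) / (1 - ‖w‖)) ^ 2 *
      Real.circleAverage (fun z => ‖H z + conj (G z)‖ ^ 2) 0 1 := by
  set C : ℝ := (1 + ‖w‖) / (1 - ‖w‖)
  set u : ℂ → ℂ := fun z => H z + conj (G z) with hu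
  have hcH := hH.continuousOn
  have hcG := hG.continuousOn
  have hcu : ContinuousOn u (ball 0 R) := by fun_prop
  have hharm : HarmonicOnNhd u (closedBall 0 1) := fun z hz => by
    have hz' := closedBall_subset_ball hR hz
    have hz'' := isOpen_ball.mem_nhds hz'
    exact (hH.analyticAt hz'').harmonicAt.add (hG.analyticAt hz'').harmonicAt_conj
  let l : ℂ →L[ℝ] ℝ := innerSL ℝ (u w)
  have hl : ∀ z, l z = inner ℝ (u w) z := fun z => rfl
  have hP := (hharm.comp_CLM l).circleAverage_poissonKernel_smul hw
  have hlu : ContinuousOn (l ∘ u) (sphere 0 |1|) :=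
    (l.continuous.comp_continuousOn hcu).mono (sphere_one_subset hR)
  have hk : ContinuousOn (poissonKernel 0 w) (sphere 0 |1|) := by
    rw [poissonKernel_eq_re_herglotzRieszKernel]
    exact Complex.continuous_re.comp_continuousOn (continuousOn_herglotzRieszKernel_sphere hw)
  have hint : CircleIntegrable (fun z => ‖u z‖ ^ 2) 0 1 :=
    circleIntegrable_of_continuousOn_ball hR (by fun_prop)
  have hint1 : CircleIntegrable (fun _ : ℂ => ‖u w‖ ^ 2 / 2) 0 1 :=
    circleIntegrable_const _ _ _
  have hint2 : CircleIntegrable (fun z => (C ^ 2 / 2) • ‖u z‖ ^ 2) 0 1 := .const_smul hint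
  have hmono := Real.circleAverage_mono (hk.smul hlu).circleIntegrable' (hint1.add hint2)
    fun z hz => ?_
  · rw [hP, Real.circleAverage_add hint1 hint2, Real.circleAverage_const,
      Real.circleAverage_fun_smul] at hmono
    simp only [Function.comp_apply, hl, real_inner_self_eq_norm_sq, smul_eq_mul] at hmono
    linarith
  · rw [abs_one] at hz
    have hle : poissonKernel 0 w z ≤ C := by
      rw [poissonKernel_eq_re_herglotzRieszKernel]
      simpa [herglotzRieszKernel_def] using re_herglotzRieszKernel_le hz hw
    have hge : 0 ≤ poissonKernel 0 w z := by
      have hz1 : ‖z‖ = 1 := mem_sphere_zero_iff_norm.1 hz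
      have hw1 : ‖w‖ < 1 := mem_ball_zero_iff.1 hw
      rw [poissonKernel_def, sub_zero, sub_zero, hz1]
      refine div_nonneg ?_ (by positivity)
      nlinarith [norm_nonneg w]
    have hin := real_inner_le_norm (u w) (u z)
    simp only [Pi.smul_apply', Function.comp_apply, Pi.add_apply, smul_eq_mul, hl]
    have h1 : poissonKernel 0 w z * inner ℝ (u w) (u z) ≤ poissonKernel 0 w z * (‖u w‖ * ‖u z‖) :=
      mul_le_mul_of_nonneg_left hin hge
    have h2 : poissonKernel 0 w z * (‖u w‖ * ‖u z‖) ≤ C * (‖u w‖ * ‖u z‖) :=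
      mul_le_mul_of_nonneg_right hle (by positivity)
    nlinarith [sq_nonneg (‖u w‖ - C * ‖u z‖)]

end CircleAverage

section Extremal

variable {f h g : ℂ → ℂ}

/-- The coefficients of the differential of `h + conj g`. -/
theorem fderiv_add_conj_apply {c : ℂ} {R : ℝ} (hR : 0 < R) (hh : DifferentiableOn ℂ h (ball c R))
    (hg : DifferentiableOn ℂ g (ball c R)) (hf : ∀ z ∈ ball c R, f z = h z + conj (g z)) (v : ℂ) :
    fderiv ℝ f c v = deriv h c * v + conj (deriv g c) * conj v := by
  have hnhds := isOpen_ball.mem_nhds (mem_ball_self (x := c) hR)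
  have h1 := (hh.differentiableAt hnhds).hasDerivAt.hasFDerivAt.restrictScalars ℝ
  have h2 := (Complex.conjCLE : ℂ →L[ℝ] ℂ).hasFDerivAt.comp c
    ((hg.differentiableAt hnhds).hasDerivAt.hasFDerivAt.restrictScalars ℝ)
  have h3 := (h1.add h2).congr_of_eventuallyEq (Filter.eventually_of_mem hnhds hf)
  rw [h3.fderiv]
  simp [mul_comm]

/-- Dilates of a harmonic map into `arctanDomain` are close to `arctanMap` when the first
coefficients of the map are close to those of `arctanMap`. -/
theorem norm_sub_arctanMap_sq_le
    (hmaps : MapsTo f unitDisc arctanDomain) (hh : DifferentiableOn ℂ h unitDisc)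
    (hg : DifferentiableOn ℂ g unitDisc) (hf : ∀ z ∈ unitDisc, f z = h z + conj (g z))
    {r : ℝ} (hr0 : 0 < r) (hr1 : r < 1) {w : ℂ} (hw : w ∈ unitDisc) :
    ‖f (r * w) - arctanMap w‖ ^ 2 ≤ ((1 + ‖w‖) / (1 - ‖w‖)) ^ 2 *
      (4 * (2 - r * (2 * deriv h 0 + conj (deriv g 0)).re)) := by
  set R := min r⁻¹ √2
  have hR : 1 < R := lt_min ((one_lt_inv₀ hr0).2 hr1) one_lt_sqrt_two
  have hscale : ∀ z ∈ ball (0 : ℂ) R, (r : ℂ) * z ∈ unitDisc := fun z hz => by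
    have hz' : ‖z‖ < r⁻¹ := (mem_ball_zero_iff.1 hz).trans_le (min_le_left _ _)
    rw [mem_ball_zero_iff, norm_mul, Complex.norm_real, Real.norm_of_nonneg hr0.le]
    calc r * ‖z‖ < r * r⁻¹ := mul_lt_mul_of_pos_left hz' hr0
      _ = 1 := mul_inv_cancel₀ hr0.ne'
  have hlin : DifferentiableOn ℂ (fun z : ℂ => (r : ℂ) * z) (ball 0 R) := by fun_prop
  set H : ℂ → ℂ := fun z => h (r * z) - arctanMap z with hHdef
  set G : ℂ → ℂ := fun z => g (r * z) with hGdef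
  have hH : DifferentiableOn ℂ H (ball 0 R) :=
    (hh.comp hlin hscale).sub fun z hz =>
      (hasDerivAt_arctanMap ((mem_ball_zero_iff.1 hz).trans_le
        (min_le_right _ _))).differentiableAt.differentiableWithinAt
  have hG : DifferentiableOn ℂ G (ball 0 R) := hg.comp hlin hscale
  have hu : ∀ z ∈ ball (0 : ℂ) R, f (r * z) - arctanMap z = H z + conj (G z) := fun z hz => by
    rw [hf _ (hscale z hz), hHdef, hGdef]
    ring
  have h0 := isOpen_ball.mem_nhds (mem_ball_self (x := (0 : ℂ)) one_pos)
  have hr' : HasDerivAt (fun z : ℂ => (r : ℂ) * z) r 0 := by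
    simpa using (hasDerivAt_id (0 : ℂ)).const_mul (r : ℂ)
  have hh0 : HasDerivAt h (deriv h 0) ((r : ℂ) * 0) := by
    rw [mul_zero]; exact (hh.differentiableAt h0).hasDerivAt
  have hg0 : HasDerivAt g (deriv g 0) ((r : ℂ) * 0) := by
    rw [mul_zero]; exact (hg.differentiableAt h0).hasDerivAt
  have hF0 : HasDerivAt arctanMap 1 0 := by
    simpa using hasDerivAt_arctanMap (z := 0) (by simp)
  have hH0 : deriv H 0 = deriv h 0 * r - 1 := ((hh0.comp 0 hr').sub hF0).deriv
  have hG0 : deriv G 0 = deriv g 0 * r := (hg0.comp 0 hr').deriv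
  have hwR : w ∈ ball (0 : ℂ) R := ball_subset_ball hR.le hw
  rw [hu w hwR]
  refine (norm_sq_le_circleAverage hR hH hG hw).trans
    (mul_le_mul_of_nonneg_left ?_ (by positivity))
  have hcH := hH.continuousOn
  have hcG := hG.continuousOn
  have i1 : CircleIntegrable (fun z => ‖H z + conj (G z)‖ ^ 2) 0 1 :=
    circleIntegrable_of_continuousOn_ball hR (by fun_prop)
  have i2 : CircleIntegrable (fun z => (H z + conj (G z)) * (2 * conj z + z)) 0 1 :=
    circleIntegrable_of_continuousOn_ball hR (by fun_prop)
  have i3 : CircleIntegrable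
      (fun z => (-4 : ℝ) • Complex.reCLM ((H z + conj (G z)) * (2 * conj z + z))) 0 1 :=
    circleIntegrable_of_continuousOn_ball hR (by fun_prop)
  have hre := Complex.reCLM.circleAverage_comp_comm i2
  refine (Real.circleAverage_mono i1 i3 fun z hz => ?_).trans_eq ?_
  · have hzR := sphere_one_subset hR hz
    rw [abs_one] at hz
    have := re_sub_arctanMap_mul_le (hmaps (hscale z hzR)) (mem_sphere_zero_iff_norm.1 hz)
    rw [hu z hzR] at this
    simp only [smul_eq_mul, Complex.reCLM_apply]
    linarith
  · rw [Real.circleAverage_fun_smul]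
    have hre' : Real.circleAverage
        (fun z => Complex.reCLM ((H z + conj (G z)) * (2 * conj z + z))) 0 1 = _ := hre
    rw [hre', circleAverage_add_conj_mul hR hH hG, hH0, hG0]
    simp
    ring

variable {a b : ℂ}

theorem exists_add_conj_of_fderiv (hharm : HarmonicOnNhd f unitDisc)
    (hab : ∀ v, fderiv ℝ f 0 v = a * v + b * conj v) :
    ∃ h g : ℂ → ℂ, DifferentiableOn ℂ h unitDisc ∧ DifferentiableOn ℂ g unitDisc ∧
      (∀ z ∈ unitDisc, f z = h z + conj (g z)) ∧ deriv h 0 = a ∧ conj (deriv g 0) = b := by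
  obtain ⟨h, g, hh, hg, hf⟩ := exists_eq_add_conj_of_harmonicOnNhd hharm
  have h1 := fderiv_add_conj_apply one_pos hh hg hf 1
  have h2 := fderiv_add_conj_apply one_pos hh hg hf Complex.I
  rw [hab] at h1 h2
  simp only [map_one, mul_one, Complex.conj_I] at h1 h2
  have hI := Complex.I_mul_I
  refine ⟨h, g, hh, hg, hf, ?_, ?_⟩
  · linear_combination (-1 / 2) * h1 + (Complex.I / 2) * h2 +
      ((deriv h 0 - conj (deriv g 0) - a + b) / 2) * hI
  · linear_combination (-1 / 2) * h1 - (Complex.I / 2) * h2 -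
      ((deriv h 0 - conj (deriv g 0) - a + b) / 2) * hI

theorem re_two_mul_add_le_two (hmaps : MapsTo f unitDisc arctanDomain)
    (hharm : HarmonicOnNhd f unitDisc) (hab : ∀ v, fderiv ℝ f 0 v = a * v + b * conj v) :
    (2 * a + b).re ≤ 2 := by
  obtain ⟨h, g, hh, hg, hf, rfl, rfl⟩ := exists_add_conj_of_fderiv hharm hab
  set x := (2 * deriv h 0 + conj (deriv g 0)).re
  by_contra! hx
  have hr0 : 0 < (2 + x) / (2 * x) := by positivity
  have hr1 : (2 + x) / (2 * x) < 1 := by rw [div_lt_one (by linarith)]; linarith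
  have := norm_sub_arctanMap_sq_le hmaps hh hg hf hr0 hr1 (mem_ball_self one_pos)
  have h1 : (2 + x) / (2 * x) * x = (2 + x) / 2 := by field_simp
  rw [h1, norm_zero] at this
  nlinarith [sq_nonneg ‖f (((2 + x) / (2 * x) : ℝ) * 0) - arctanMap 0‖]

theorem eqOn_arctanMap_of_two_mul_add_eq_two (hmaps : MapsTo f unitDisc arctanDomain)
    (hharm : HarmonicOnNhd f unitDisc) (hab : ∀ v, fderiv ℝ f 0 v = a * v + b * conj v)
    (h2 : 2 * a + b = 2) : EqOn f arctanMap unitDisc := by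
  obtain ⟨h, g, hh, hg, hf, rfl, rfl⟩ := exists_add_conj_of_fderiv hharm hab
  intro w hw
  have hfw : ContinuousAt f w := (hharm w hw).1.continuousAt
  have hT : Filter.Tendsto (fun r : ℝ => ‖f (r * w) - arctanMap w‖ ^ 2) (nhdsWithin 1 (Iio 1))
      (nhds (‖f w - arctanMap w‖ ^ 2)) := by
    have hlin : Filter.Tendsto (fun r : ℝ => (r : ℂ) * w) (nhdsWithin 1 (Iio 1)) (nhds w) := by
      have : Continuous fun r : ℝ => (r : ℂ) * w := by fun_prop
      simpa using (this.tendsto 1).mono_left nhdsWithin_le_nhds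
    exact (((hfw.tendsto.comp hlin).sub_const _).norm).pow 2
  have hB : Filter.Tendsto (fun r : ℝ => ((1 + ‖w‖) / (1 - ‖w‖)) ^ 2 * (4 * (2 - r * 2)))
      (nhdsWithin 1 (Iio 1)) (nhds 0) := by
    have : Continuous fun r : ℝ => ((1 + ‖w‖) / (1 - ‖w‖)) ^ 2 * (4 * (2 - r * 2)) := by fun_prop
    simpa using (this.tendsto 1).mono_left nhdsWithin_le_nhds
  have hle := le_of_tendsto_of_tendsto hT hB (by
    filter_upwards [Ioo_mem_nhdsLT (show (0 : ℝ) < 1 by norm_num)] with r hr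
    have := norm_sub_arctanMap_sq_le hmaps hh hg hf hr.1 hr.2 hw
    rwa [h2] at this)
  exact sub_eq_zero.1 (norm_eq_zero.1 (pow_eq_zero_iff two_ne_zero |>.1
    (le_antisymm hle (sq_nonneg _))))

end Extremal

section LinearMap

variable {L : ℂ →L[ℝ] ℂ} {a b : ℂ}

theorem IsConformalMap.exists_eq_mul_or_eq_mul_conj (hL : IsConformalMap L) :
    ∃ a : ℂ, (∀ v, L v = a * v) ∨ ∀ v, L v = a * conj v := by
  rcases hL.is_complex_or_conj_linear with ⟨M, hM⟩ | ⟨M, hM⟩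
  · refine ⟨M 1, Or.inl fun v => ?_⟩
    rw [← hM, ContinuousLinearMap.coe_restrictScalars', mul_comm, ← smul_eq_mul, ← map_smul,
      smul_eq_mul, mul_one]
  · refine ⟨M 1, Or.inr fun v => ?_⟩
    have h : M (conj v) = L v := by
      have := congrArg (fun T : ℂ →L[ℝ] ℂ => T (conj v)) hM
      simpa using this
    rw [← h, mul_comm, ← smul_eq_mul, ← map_smul, smul_eq_mul, mul_one]

theorem norm_of_forall_norm_eq (h : ∀ v, ‖L v‖ = ‖a‖ * ‖v‖) : ‖L‖ = ‖a‖ := by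
  refine le_antisymm (L.opNorm_le_bound (norm_nonneg a) fun v => (h v).le) ?_
  simpa using (h 1).symm.le.trans (L.le_opNorm 1)

theorem det_of_apply_eq (h : ∀ v, L v = a * v + b * conj v) :
    L.det = ‖a‖ ^ 2 - ‖b‖ ^ 2 := by
  rw [ContinuousLinearMap.det, ← LinearMap.det_toMatrix Complex.basisOneI, Matrix.det_fin_two]
  simp only [LinearMap.toMatrix_apply, Complex.coe_basisOneI, Complex.coe_basisOneI_repr,
    ContinuousLinearMap.coe_coe, h]
  rw [← Complex.normSq_eq_norm_sq, ← Complex.normSq_eq_norm_sq, Complex.normSq_apply,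
    Complex.normSq_apply]
  simp
  ring

end LinearMap

variable {f : ℂ → ℂ} {a b : ℂ}

theorem conj_mem_arctanDomain {w : ℂ} (hw : w ∈ arctanDomain) : conj w ∈ arctanDomain := by
  rw [arctanDomain_eq] at hw ⊢
  refine ⟨by simpa [arctanStrip] using hw.1, ?_⟩
  have := hw.2
  simpa [arctanDefining] using this

theorem mul_mem_unitDisc {c z : ℂ} (hc : ‖c‖ = 1) (hz : z ∈ unitDisc) : c * z ∈ unitDisc := by
  rw [mem_ball_zero_iff] at hz ⊢
  rwa [norm_mul, hc, one_mul]

theorem harmonicOnNhd_comp_mul {c : ℂ} (hc : ‖c‖ = 1) (hf : HarmonicOnNhd f unitDisc) :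
    HarmonicOnNhd (fun z => f (c * z)) unitDisc := by
  obtain ⟨h, g, hh, hg, hfe⟩ := exists_eq_add_conj_of_harmonicOnNhd hf
  have hlin : DifferentiableOn ℂ (fun z : ℂ => c * z) unitDisc := by fun_prop
  have hm : MapsTo (fun z : ℂ => c * z) unitDisc unitDisc := fun z hz => mul_mem_unitDisc hc hz
  intro z hz
  have hn := isOpen_ball.mem_nhds hz
  have hsum := ((hh.comp hlin hm).analyticAt hn).harmonicAt.add
    ((hg.comp hlin hm).analyticAt hn).harmonicAt_conj
  exact (harmonicAt_congr_nhds (Filter.eventually_of_mem hn fun y hy => hfe _ (hm hy))).2 hsum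

theorem fderiv_comp_mul {c : ℂ} (hf : HarmonicOnNhd f unitDisc)
    (hab : ∀ v, fderiv ℝ f 0 v = a * v + b * conj v) (v : ℂ) :
    fderiv ℝ (fun z => f (c * z)) 0 v = a * c * v + b * conj c * conj v := by
  have hd : HasFDerivAt f (fderiv ℝ f 0) (c * 0) := by
    rw [mul_zero]
    exact ((hf 0 (mem_ball_self one_pos)).1.differentiableAt two_ne_zero).hasFDerivAt
  have hl : HasFDerivAt (fun z : ℂ => c * z) (c • ContinuousLinearMap.id ℝ ℂ) 0 :=
    (hasFDerivAt_id (𝕜 := ℝ) (0 : ℂ)).const_mul c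
  have := (hd.comp (0 : ℂ) hl).fderiv
  rw [Function.comp_def] at this
  rw [this]
  simp [hab]
  ring

theorem exists_norm_eq_one_mul_eq_norm (a : ℂ) : ∃ c : ℂ, ‖c‖ = 1 ∧ a * c = ‖a‖ := by
  rcases eq_or_ne a 0 with rfl | ha
  · exact ⟨1, by simp⟩
  · have ha' : (‖a‖ : ℂ) ≠ 0 := by simpa using ha
    refine ⟨conj a / ‖a‖, by simp [ha], ?_⟩
    rw [← mul_div_assoc, Complex.mul_conj', sq, mul_div_assoc, div_self ha', mul_one]

/-- The Schwarz lemma for harmonic maps into `arctanDomain` with complex linear differential. -/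
theorem norm_le_one_of_fderiv_eq_mul (hmaps : MapsTo f unitDisc arctanDomain)
    (hharm : HarmonicOnNhd f unitDisc) (ha : ∀ v, fderiv ℝ f 0 v = a * v) : ‖a‖ ≤ 1 := by
  obtain ⟨c, hc, hac⟩ := exists_norm_eq_one_mul_eq_norm a
  have hab : ∀ v, fderiv ℝ f 0 v = a * v + 0 * conj v := fun v => by simp [ha]
  have := re_two_mul_add_le_two (f := fun z => f (c * z))
    (fun z hz => hmaps (mul_mem_unitDisc hc hz)) (harmonicOnNhd_comp_mul hc hharm)
    (fderiv_comp_mul hharm hab)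
  rw [hac] at this
  simp at this
  linarith

/-- The equality case of the Schwarz lemma. -/
theorem eqOn_of_fderiv_eq_mul (hmaps : MapsTo f unitDisc arctanDomain)
    (hharm : HarmonicOnNhd f unitDisc) (ha : ∀ v, fderiv ℝ f 0 v = a * v) (h1 : ‖a‖ = 1) :
    EqOn f (fun z => arctanMap (a * z)) unitDisc := by
  have hab : ∀ v, fderiv ℝ f 0 v = a * v + 0 * conj v := fun v => by simp [ha]
  have hc : ‖conj a‖ = 1 := by rwa [Complex.norm_conj]
  have haa : a * conj a = 1 := by rw [Complex.mul_conj', h1]; simp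
  have := eqOn_arctanMap_of_two_mul_add_eq_two (f := fun z => f (conj a * z))
    (fun z hz => hmaps (mul_mem_unitDisc hc hz)) (harmonicOnNhd_comp_mul hc hharm)
    (fderiv_comp_mul hharm hab) (by rw [haa]; simp)
  intro z hz
  have h := this (mul_mem_unitDisc h1 hz)
  simpa [← mul_assoc, mul_comm (conj a) a, haa] using h

theorem IsCompetitor.norm_fderiv_le_one (hf : IsCompetitor arctanDomain 0 f) :
    ‖fderiv ℝ f 0‖ ≤ 1 := by
  rcases hf.conformal with h | h
  · simp [h]
  obtain ⟨a, ha | ha⟩ := h.exists_eq_mul_or_eq_mul_conj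
  · rw [norm_of_forall_norm_eq (a := a) fun v => by rw [ha, norm_mul]]
    exact norm_le_one_of_fderiv_eq_mul hf.mapsTo hf.harmonic ha
  · rw [norm_of_forall_norm_eq (a := a) fun v => by rw [ha, norm_mul, Complex.norm_conj],
      ← Complex.norm_conj]
    have hd := ((hf.harmonic 0 (mem_ball_self one_pos)).1.differentiableAt two_ne_zero).hasFDerivAt
    have hcomp := ((Complex.conjCLE : ℂ →L[ℝ] ℂ).hasFDerivAt.comp (0 : ℂ) hd).fderiv
    refine norm_le_one_of_fderiv_eq_mul (f := (Complex.conjCLE : ℂ →L[ℝ] ℂ) ∘ f)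
      (fun z hz => conj_mem_arctanDomain (hf.mapsTo hz)) (hf.harmonic.comp_CLM _) fun v => ?_
    rw [hcomp]
    simp [ha]

/-- The rotations of `arctanMap` are competitors whose differential has norm `1`. -/
theorem isCompetitor_and_fderiv_of_eqOn {c : ℂ} (hc : ‖c‖ = 1)
    (hf : EqOn f (fun z => arctanMap (c * z)) unitDisc) :
    IsCompetitor arctanDomain 0 f ∧ (∀ v, fderiv ℝ f 0 v = c * v) := by
  have hF : ∀ z ∈ unitDisc, ‖c * z‖ < √2 := fun z hz =>
    (mem_ball_zero_iff.1 (mul_mem_unitDisc hc hz)).trans one_lt_sqrt_two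
  have h0 : (0 : ℂ) ∈ unitDisc := mem_ball_self one_pos
  have hd : DifferentiableOn ℂ f unitDisc := fun z hz =>
    (((hasDerivAt_arctanMap (hF z hz)).comp z
      ((hasDerivAt_id z).const_mul c)).differentiableAt.differentiableWithinAt).congr hf (hf hz)
  have hderiv : HasDerivAt f c 0 := by
    have h := (hasDerivAt_arctanMap (hF 0 h0)).comp 0 ((hasDerivAt_id (0 : ℂ)).const_mul c)
    refine (h.congr_of_eventuallyEq
      (Filter.eventually_of_mem (isOpen_ball.mem_nhds h0) hf)).congr_deriv ?_
    simp
  have hfd := hderiv.hasFDerivAt.restrictScalars ℝ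
  have hfd' : ∀ v, fderiv ℝ f 0 v = c * v := fun v => by
    rw [hfd.fderiv]; simp [mul_comm]
  refine ⟨⟨fun z hz => ?_, fun z hz => (hd.analyticAt (isOpen_ball.mem_nhds hz)).harmonicAt, ?_,
    Or.inr ?_⟩, hfd'⟩
  · rw [hf hz]
    exact mem_image_of_mem _ (mul_mem_unitDisc hc hz)
  · rw [hf h0]
    simp [arctanMap_zero]
  · rw [hfd.fderiv]
    refine isConformalMap_complex_linear fun h => ?_
    have := congrArg (fun T : ℂ →L[ℂ] ℂ => T 1) h
    simp at this
    simp [this] at hc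

theorem bddAbove_competitorNorms : BddAbove (competitorNorms arctanDomain 0) :=
  ⟨1, by rintro s ⟨f, hf, rfl⟩; exact hf.norm_fderiv_le_one⟩

theorem norm_fderiv_eq_norm {c : ℂ} (h : ∀ v, fderiv ℝ f 0 v = c * v) : ‖fderiv ℝ f 0‖ = ‖c‖ :=
  norm_of_forall_norm_eq fun v => by rw [h, norm_mul]

theorem extremalValue_arctanDomain : extremalValue arctanDomain 0 = 1 := by
  obtain ⟨hc, hd⟩ := isCompetitor_and_fderiv_of_eqOn (f := arctanMap) (c := 1) (by simp) fun z _ => by simp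
  have hmem : (1 : ℝ) ∈ competitorNorms arctanDomain 0 :=
    ⟨arctanMap, hc, by rw [norm_fderiv_eq_norm hd, norm_one]⟩
  refine le_antisymm (csSup_le ⟨1, hmem⟩ ?_) (le_csSup bddAbove_competitorNorms hmem)
  rintro s ⟨f, hf, rfl⟩
  exact hf.norm_fderiv_le_one

theorem det_fderiv_eq {c : ℂ} (h : ∀ v, fderiv ℝ f 0 v = c * v) :
    (fderiv ℝ f 0).det = ‖c‖ ^ 2 := by
  rw [det_of_apply_eq (a := c) (b := 0) fun v => by simp [h]]
  simp

/-- The orientation preserving extremal maps for `arctanDomain`, in terms of the differential. -/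
theorem isExtremal_and_orientationPreserving_iff :
    (IsExtremal arctanDomain 0 f ∧ OrientationPreservingAtZero f) ↔
      ∃ c : ℂ, ‖c‖ = 1 ∧ (∀ v, fderiv ℝ f 0 v = c * v) ∧
        EqOn f (fun z => arctanMap (c * z)) unitDisc := by
  constructor
  · rintro ⟨⟨hf, -, hn⟩, hdet⟩
    rw [extremalValue_arctanDomain] at hn
    unfold OrientationPreservingAtZero at hdet
    rcases hf.conformal with h | h
    · simp [h] at hn
    obtain ⟨c, hc | hc⟩ := h.exists_eq_mul_or_eq_mul_conj
    · rw [norm_fderiv_eq_norm hc] at hn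
      exact ⟨c, hn, hc, eqOn_of_fderiv_eq_mul hf.mapsTo hf.harmonic hc hn⟩
    · rw [det_of_apply_eq (a := 0) (b := c) fun v => by simp [hc]] at hdet
      simp at hdet
      linarith [sq_nonneg ‖c‖]
  · rintro ⟨c, hc, hd, he⟩
    obtain ⟨hf, -⟩ := isCompetitor_and_fderiv_of_eqOn hc he
    refine ⟨⟨hf, bddAbove_competitorNorms, ?_⟩, ?_⟩
    · rw [extremalValue_arctanDomain, norm_fderiv_eq_norm hd, hc]
    · rw [OrientationPreservingAtZero, det_fderiv_eq hd, hc]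
      norm_num

theorem wirtingerDz_eq {c : ℂ} (h : ∀ v, fderiv ℝ f 0 v = c * v) : wirtingerDz f 0 = c := by
  rw [wirtingerDz, h, h]
  linear_combination (-c / 2) * Complex.I_mul_I

theorem corollary3p3 :
    IsBoundedStronglyConvexDomain arctanDomain ∧
    (0 : ℂ) ∈ arctanDomain ∧
    ¬ IsRoundDisc arctanDomain ∧
    IsBiholomorphicOnto arctanMap unitDisc arctanDomain ∧
    arctanMap 0 = 0 ∧
    -- the supremum is finite and attained by the biholomorphism
    IsExtremal arctanDomain 0 arctanMap ∧
    -- the orientation preserving extremals are exactly the rotations of the biholomorphism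
    (∀ f : ℂ → ℂ, (IsExtremal arctanDomain 0 f ∧ OrientationPreservingAtZero f) ↔
      ∃ θ : ℝ, EqOn f (fun z => arctanMap (Complex.exp (θ * Complex.I) * z)) unitDisc) ∧
    -- the normalized extremal is unique
    (∀ f : ℂ → ℂ, (IsExtremal arctanDomain 0 f ∧ OrientationPreservingAtZero f ∧
        (wirtingerDz f 0).im = 0 ∧ 0 < (wirtingerDz f 0).re) ↔
      EqOn f arctanMap unitDisc) ∧
    -- hence a domain whose extremal value is attained by a biholomorphism need not be a disc
    ¬ (∀ (D : Set ℂ) (p : ℂ), IsBoundedStronglyConvexDomain D → p ∈ D →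
        (∃ Φ : ℂ → ℂ, IsBiholomorphicOnto Φ unitDisc D ∧ Φ 0 = p ∧ IsExtremal D p Φ) →
        IsRoundDisc D) := by

  have hF : IsExtremal arctanDomain 0 arctanMap :=
    (isExtremal_and_orientationPreserving_iff.2 ⟨1, norm_one,
      (isCompetitor_and_fderiv_of_eqOn norm_one fun z _ => by simp).2, fun z _ => by simp⟩).1
  refine ⟨isBoundedStronglyConvexDomain_arctanDomain, zero_mem_arctanDomain,
    not_isRoundDisc_arctanDomain, isBiholomorphicOnto_arctanMap, arctanMap_zero, hF,
    fun f => ?_, fun f => ?_, fun h => ?_⟩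
  · rw [isExtremal_and_orientationPreserving_iff]
    constructor
    · rintro ⟨c, hc, -, he⟩
      obtain ⟨θ, rfl⟩ := Complex.norm_eq_one_iff c |>.1 hc
      exact ⟨θ, he⟩
    · rintro ⟨θ, he⟩
      have hc := Complex.norm_exp_ofReal_mul_I θ
      exact ⟨_, hc, (isCompetitor_and_fderiv_of_eqOn hc he).2, he⟩
  · rw [← and_assoc, isExtremal_and_orientationPreserving_iff]
    constructor
    · rintro ⟨⟨c, hc, hd, he⟩, him, hre⟩
      rw [wirtingerDz_eq hd] at him hre
      have hc1 : c = 1 := by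
        have : c = (c.re : ℂ) := Complex.ext rfl (by simp [him])
        rw [this, Complex.norm_real, Real.norm_of_nonneg hre.le] at hc
        rw [this, hc, Complex.ofReal_one]
      simpa [hc1] using he
    · intro he
      have he' : EqOn f (fun z => arctanMap (1 * z)) unitDisc := by simpa using he
      have hd := (isCompetitor_and_fderiv_of_eqOn norm_one he').2
      refine ⟨⟨1, norm_one, hd, he'⟩, ?_⟩
      rw [wirtingerDz_eq hd]
      simp
  · exact not_isRoundDisc_arctanDomain (h _ 0 isBoundedStronglyConvexDomain_arctanDomain
      zero_mem_arctanDomain ⟨arctanMap, isBiholomorphicOnto_arctanMap, arctanMap_zero, hF⟩)
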